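/- Let $\mathcal{M}_n$ be the set of all $n\times n$ permutation matrices, i.e. the bipartite adjacency matrices of perfect matchings between two (given) copies of $[n]$. Consider learning a hidden $M\in\mathcal{M}_n$, i.e. computing the identity function on $\mathcal{M}_n$, by edge queries, where a query $(i,j)\in[n]\times[n]$ returns the entry $M_{ij}$. Let $\mathsf{D}(\mathcal{M}_n)$ be the least depth of a deterministic decision tree, with leaves labelled by elements of $\mathcal{M}_n$, whose output is $M$ on every input $M\in\mathcal{M}_n$. Let $\mathsf{R}(\mathcal{M}_n)$ be the least depth of a randomized decision tree (a probability distribution over deterministic decision trees; its depth is the maximum depth of a tree in its support) whose output on every input $M\in\mathcal{M}_n$ is $M$ with probability at least $2/3$. Let $\mathsf{Q}(\mathcal{M}_n)$ be the least $T$ for which there are a fixed initial state in a finite-dimensional Hilbert space and fixed unitaries $U_0,\dots,U_T$ such that, for every input $M\in\mathcal{M}_n$, measuring the state obtained by applying $U_0,O_M,U_1,O_M,\dots,O_M,U_T$ gives the outcome $M$ with probability at least $2/3$, where $O_M$ maps $|(i,j)\rangle|b\rangle$ to $|(i,j)\rangle|b+M_{ij} \bmod 2\rangle$ and acts as the identity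 on the workspace. Then for every natural number $n \ge 1$, $$\mathsf{D}(\mathcal{M}_n)=\frac{n(n-1)}{2},\qquad \mathsf{R}(\mathcal{M}_n)=\Theta(n^2),\qquad \mathsf{Q}(\mathcal{M}_n)=\Theta(n^{1.5}).$$ Here $g(n)=\Theta(h(n))$ means that there are absolute constants $c,C>0$ with $g(n)\le C\,h(n)$ for all $n\ge 1$ and $c\,h(n)\le g(n)$ for all $n\ge 2$ (for $n=1$ all three complexities are $0$). -/

import Mathlib

universe u v

/-! Throughout, the input is a bit string `x : ι → Bool` over a finite index type `ι`, promised to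
lie in a set `D`, and the task is to compute a function `f : D → R`. Query complexities take values
in `ℕ∞`; the value `⊤` means that no algorithm computes `f`. -/

/-- Deterministic decision trees querying bits indexed by `ι`, with outputs in `R`. In `node i t₀ t₁`
the bit `i` is queried, and the computation goes on in `t₀` if it is `0` and in `t₁` if it is `1`. -/
inductive DecisionTree (ι : Type u) (R : Type v) : Type (max u v) where
  | leaf : R → DecisionTree ι R
  | node : ι → DecisionTree ι R → DecisionTree ι R → DecisionTree ι R

namespace DecisionTree

variable {ι : Type u} {R : Type v}

/-- The output of a decision tree on an input. -/
def eval : DecisionTree ι R → (ι → Bool) → R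
  | leaf r, _ => r
  | node i t₀ t₁, x => if x i = true then t₁.eval x else t₀.eval x

/-- The depth: the largest number of queries on a root-to-leaf path. -/
def depth : DecisionTree ι R → ℕ
  | leaf _ => 0
  | node _ t₀ t₁ => max t₀.depth t₁.depth + 1

/-- The tree outputs `f x` on every `x ∈ D`. -/
def Computes (t : DecisionTree ι R) {D : Set (ι → Bool)} (f : D → R) : Prop :=
  ∀ x : D, t.eval x = f x

end DecisionTree

/-- Deterministic query complexity: the least depth of a decision tree computing `f`. -/
noncomputable def deterministicQueryComplexity {ι : Type u} {R : Type v} {D : Set (ι → Bool)}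
    (f : D → R) : ℕ∞ :=
  ⨅ (t : DecisionTree ι R) (_ : t.Computes f), (t.depth : ℕ∞)

/-- A randomized decision tree is a probability distribution over deterministic decision trees. -/
abbrev RandomizedDecisionTree (ι : Type u) (R : Type v) : Type (max u v) :=
  PMF (DecisionTree ι R)

namespace RandomizedDecisionTree

variable {ι : Type u} {R : Type v}

/-- The probability of the output `r` on the input `x`. -/
noncomputable def outputProb (μ : RandomizedDecisionTree ι R) (x : ι → Bool) (r : R) : ENNReal :=
  PMF.map (fun t : DecisionTree ι R => t.eval x) μ r

/-- On every `x ∈ D` the output is `f x` with probability at least `2/3`. -/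
def Computes (μ : RandomizedDecisionTree ι R) {D : Set (ι → Bool)} (f : D → R) : Prop :=
  ∀ x : D, 2 / 3 ≤ outputProb μ x (f x)

/-- The largest depth of a deterministic tree in the support. -/
noncomputable def depth (μ : RandomizedDecisionTree ι R) : ℕ∞ :=
  ⨆ t ∈ PMF.support μ, (DecisionTree.depth t : ℕ∞)

end RandomizedDecisionTree

/-- Randomized (worst-case, error `1/3`) query complexity. -/
noncomputable def randomizedQueryComplexity {ι : Type u} {R : Type v} {D : Set (ι → Bool)}
    (f : D → R) : ℕ∞ :=
  ⨅ (μ : RandomizedDecisionTree ι R) (_ : RandomizedDecisionTree.Computes μ f),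
    RandomizedDecisionTree.depth μ

/-- The computational basis states `|i⟩|b⟩|z⟩`: a query index, a query bit, and a workspace
register of dimension `w`. -/
abbrev QBasis (ι : Type u) (w : ℕ) : Type u := ι × Bool × Fin w

/-- The query operation `|i⟩|b⟩|z⟩ ↦ |i⟩|b + x i mod 2⟩|z⟩`, as a matrix. -/
def queryMatrix {ι : Type u} [DecidableEq ι] (w : ℕ) (x : ι → Bool) :
    Matrix (QBasis ι w) (QBasis ι w) ℂ :=
  Matrix.of fun p q => if p = (q.1, xor q.2.1 (x q.1), q.2.2) then 1 else 0

/-- A quantum query algorithm: a fixed unit vector as initial state, input-independent unitaries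
`U 0, …, U queries` (further values of `U` are not used) that alternate with the query operation,
and a final measurement in the computational basis (since `U queries` is arbitrary, this amounts to
an arbitrary projective measurement), whose outcome `k` is reported as `out k`. -/
structure QuantumQueryAlgorithm (ι : Type u) [Fintype ι] [DecidableEq ι] (R : Type v) where
  /-- dimension of the workspace register -/
  w : ℕ
  /-- number of applications of the query operation -/
  queries : ℕ
  /-- initial state -/
  init : QBasis ι w → ℂ
  norm_init : ∑ k, ‖init k‖ ^ 2 = 1
  /-- unitaries between the queries -/
  U : ℕ → Matrix.unitaryGroup (QBasis ι w) ℂ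
  /-- label of each measurement outcome -/
  out : QBasis ι w → R

namespace QuantumQueryAlgorithm

variable {ι : Type u} [Fintype ι] [DecidableEq ι] {R : Type v}

/-- The state `U t O_x U (t-1) O_x ⋯ O_x U 0 |init⟩` after `t` queries. -/
noncomputable def state (A : QuantumQueryAlgorithm ι R) (x : ι → Bool) : ℕ → QBasis ι A.w → ℂ
  | 0 => Matrix.mulVec (A.U 0 : Matrix (QBasis ι A.w) (QBasis ι A.w) ℂ) A.init
  | t + 1 => Matrix.mulVec (A.U (t + 1) : Matrix (QBasis ι A.w) (QBasis ι A.w) ℂ)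
      (Matrix.mulVec (queryMatrix A.w x) (A.state x t))

open Classical in
/-- The probability of the output `r` on the input `x`. -/
noncomputable def outputProb (A : QuantumQueryAlgorithm ι R) (x : ι → Bool) (r : R) : ℝ :=
  ∑ k, if A.out k = r then ‖A.state x A.queries k‖ ^ 2 else 0

/-- On every `x ∈ D` the output is `f x` with probability at least `2/3`. -/
def Computes (A : QuantumQueryAlgorithm ι R) {D : Set (ι → Bool)} (f : D → R) : Prop :=
  ∀ x : D, 2 / 3 ≤ A.outputProb x (f x)

end QuantumQueryAlgorithm

/-- Quantum (bounded-error `1/3`) query complexity. -/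
noncomputable def quantumQueryComplexity {ι : Type u} [Fintype ι] [DecidableEq ι] {R : Type v}
    {D : Set (ι → Bool)} (f : D → R) : ℕ∞ :=
  ⨅ (A : QuantumQueryAlgorithm ι R) (_ : A.Computes f), (A.queries : ℕ∞)

/-- Bipartite adjacency matrices of bipartite graphs on `[n] ∪ [n]`, written as bit strings indexed
by the possible edges: an edge query `(i, j)` reads the entry `(i, j)`. -/
abbrev BipartiteMatrix (n : ℕ) : Type := Fin n × Fin n → Bool

/-- The identity matrix. -/
def identityMatrix (n : ℕ) : BipartiteMatrix n := fun p => decide (p.1 = p.2)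

/-- Adjacency matrices of matchings: all matrices obtained from the identity matrix by row and
column permutations. -/
def matchingMatrices (n : ℕ) : Set (BipartiteMatrix n) :=
  {M | ∃ σ τ : Equiv.Perm (Fin n), ∀ i j : Fin n, M (i, j) = identityMatrix n (σ i, τ j)}

/-- Deterministic edge query complexity of learning a hidden graph from the class `𝒢`: the
complexity of the identity function on `𝒢`. -/
noncomputable def learnD {n : ℕ} (𝒢 : Set (BipartiteMatrix n)) : ℕ∞ :=
  deterministicQueryComplexity (id : 𝒢 → 𝒢)

/-- Randomized edge query complexity of learning a hidden graph from the class `𝒢`. -/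
noncomputable def learnR {n : ℕ} (𝒢 : Set (BipartiteMatrix n)) : ℕ∞ :=
  randomizedQueryComplexity (id : 𝒢 → 𝒢)

/-- Quantum edge query complexity of learning a hidden graph from the class `𝒢`. -/
noncomputable def learnQ {n : ℕ} (𝒢 : Set (BipartiteMatrix n)) : ℕ∞ :=
  quantumQueryComplexity (id : 𝒢 → 𝒢)

/-! ### Permutation matrices -/

/-! The inputs are the matrices `permBits π`, and each of the three measures gets its own argument.

Deterministic: finding the one of a row among `m` remaining columns takes `m - 1` queries, since the
last candidate is known by elimination; summing over rows gives the upper bound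
(`DecisionTree.exists_of_agree`). Conversely, an adversary answers `0` while some permutation
survives. In the end the zeros leave a single `π`, so they exclude `π * swap a b` for every pair `a
≠ b`, and different pairs need different zeros (`choose_two_le_card_of_unique`).

Randomized: every input has only `n` ones, so a correct leaf lies at the end of a path with few
answers `1`. A shallow tree has too few such paths to be correct on two thirds of all `n!` inputs,
and averaging over inputs transfers this to distributions over trees.

Quantum lower bound: sum the squared distance of the states on `π` and `π * swap a b` over all `π`
and `a ≠ b`. It starts at `0` and must end at order `n ^ 2 * n!`. A bit `1` is changed by at most `2
* n` of these swaps, a bit `0` by at most `2`; weighting the two cases by `1 / √n` and `√n` bounds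
the progress per query by order `√n * n!` (`adversary_bound`).

Quantum upper bound: exact Grover search with `⌈√n⌉` queries in each row. Only the states are
written down: unitaries between them exist as soon as the Gram matrices agree
(`exists_unitary_of_gram_eq`), and these are computed by trigonometry (`grover_identity`). -/

/-- The permutation matrix of `π`, as a bit string. -/
def permBits {n : ℕ} (π : Equiv.Perm (Fin n)) : BipartiteMatrix n := fun p => decide (π p.1 = p.2)

theorem permBits_eq_true {n : ℕ} {π : Equiv.Perm (Fin n)} {p : Fin n × Fin n} :
    permBits π p = true ↔ π p.1 = p.2 := by simp [permBits]

theorem permBits_injective {n : ℕ} : Function.Injective (permBits (n := n)) := by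
  intro π ρ h
  ext1 i
  have h' : permBits ρ (i, π i) = true := by rw [← h]; simp [permBits]
  exact (permBits_eq_true.1 h').symm

theorem mem_matchingMatrices_iff {n : ℕ} {M : BipartiteMatrix n} :
    M ∈ matchingMatrices n ↔ ∃ π, permBits π = M := by
  constructor
  · rintro ⟨σ, τ, h⟩
    refine ⟨σ.trans τ.symm, ?_⟩
    funext ⟨i, j⟩
    simp [permBits, h, identityMatrix, Equiv.symm_apply_eq]
  · rintro ⟨π, rfl⟩
    exact ⟨π, 1, fun i j => rfl⟩

/-- Permutations correspond to matchings. -/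
noncomputable def permEquivMatching (n : ℕ) : Equiv.Perm (Fin n) ≃ matchingMatrices n :=
  Equiv.ofBijective (fun π => ⟨permBits π, mem_matchingMatrices_iff.2 ⟨π, rfl⟩⟩)
    ⟨fun _ _ h => permBits_injective (congrArg Subtype.val h),
     fun ⟨_, h⟩ => (mem_matchingMatrices_iff.1 h).imp fun _ h => Subtype.ext h⟩

@[simp]
theorem coe_permEquivMatching {n : ℕ} (π : Equiv.Perm (Fin n)) :
    (permEquivMatching n π : BipartiteMatrix n) = permBits π := rfl

theorem card_filter_permBits {n : ℕ} (π : Equiv.Perm (Fin n)) :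
    (Finset.univ.filter fun p => permBits π p = true).card = n := by
  have : (Finset.univ.filter fun p => permBits π p = true) =
      Finset.univ.image fun i => (i, π i) := by
    ext ⟨i, j⟩
    simp [permBits]
  rw [this, Finset.card_image_of_injective _ fun i j h => congrArg Prod.fst h]
  simp

/-! ### Deterministic query complexity -/

/-- Rows `k` and above are already known, so the rows below share `k` candidate columns; the highest
unknown row is searched, and induction handles the rest. -/
theorem DecisionTree.exists_of_agree {n : ℕ} (k : ℕ) (hk : k ≤ n)
    (S : Finset (Equiv.Perm (Fin n)))
    (hS : ∀ π ∈ S, ∀ ρ ∈ S, ∀ i : Fin n, k ≤ i → π i = ρ i) :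
    ∃ t : DecisionTree (Fin n × Fin n) (matchingMatrices n), t.depth ≤ k * (k - 1) / 2 ∧
      ∀ π ∈ S, t.eval (permBits π) = permEquivMatching n π := by
  induction k generalizing S with
  | zero =>
    rcases S.eq_empty_or_nonempty with rfl | ⟨π₀, h₀⟩
    · exact ⟨.leaf (permEquivMatching n 1), by simp [DecisionTree.depth], by simp⟩
    · refine ⟨.leaf (permEquivMatching n π₀), by simp [DecisionTree.depth], fun π hπ => ?_⟩
      rw [Equiv.ext fun i => hS π hπ π₀ h₀ i (Nat.zero_le _)]
      rfl
  | succ k ih =>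
    rcases S.eq_empty_or_nonempty with rfl | ⟨π₀, h₀⟩
    · exact ⟨.leaf (permEquivMatching n 1), by simp [DecisionTree.depth], by simp⟩
    let r : Fin n := ⟨k, hk⟩
    have key : ∀ (l : ℕ) (C : Finset (Fin n)) (S' : Finset (Equiv.Perm (Fin n))), S' ⊆ S →
        C.card = l + 1 → (∀ π ∈ S', π r ∈ C) →
        ∃ t : DecisionTree (Fin n × Fin n) (matchingMatrices n),
          t.depth ≤ k * (k - 1) / 2 + l ∧
          ∀ π ∈ S', t.eval (permBits π) = permEquivMatching n π := by
      have base : ∀ (c : Fin n) (S' : Finset (Equiv.Perm (Fin n))), S' ⊆ S →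
          (∀ π ∈ S', π r = c) →
          ∃ t : DecisionTree (Fin n × Fin n) (matchingMatrices n), t.depth ≤ k * (k - 1) / 2 ∧
            ∀ π ∈ S', t.eval (permBits π) = permEquivMatching n π := by
        intro c S' hS' hc
        refine ih (by omega) S' fun π hπ ρ hρ i hi => ?_
        rcases hi.eq_or_lt with h | h
        · have : i = r := Fin.ext h.symm
          rw [this, hc π hπ, hc ρ hρ]
        · exact hS π (hS' hπ) ρ (hS' hρ) i h
      intro l
      induction l with
      | zero =>
        intro C S' hS' hC hm
        obtain ⟨c, rfl⟩ := Finset.card_eq_one.1 hC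
        -- A single candidate column needs no query; this saves one query per row.
        exact base c S' hS' fun π hπ => Finset.mem_singleton.1 (hm π hπ)
      | succ l ihl =>
        intro C S' hS' hC hm
        obtain ⟨c, hc⟩ : C.Nonempty := Finset.card_pos.1 (by omega)
        obtain ⟨t₁, hd₁, he₁⟩ := base c (S'.filter fun π => π r = c)
          ((Finset.filter_subset _ _).trans hS') (by simp)
        obtain ⟨t₀, hd₀, he₀⟩ := ihl (C.erase c) (S'.filter fun π => π r ≠ c)
          ((Finset.filter_subset _ _).trans hS') (by rw [Finset.card_erase_of_mem hc]; omega)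
          (fun π hπ => by
            rw [Finset.mem_filter] at hπ
            exact Finset.mem_erase.2 ⟨hπ.2, hm π hπ.1⟩)
        refine ⟨.node (r, c) t₀ t₁, by simp only [DecisionTree.depth]; omega, fun π hπ => ?_⟩
        simp only [DecisionTree.eval, permBits_eq_true]
        split_ifs with h
        · exact he₁ π (Finset.mem_filter.2 ⟨hπ, h⟩)
        · exact he₀ π (Finset.mem_filter.2 ⟨hπ, h⟩)
    -- The `k + 1` candidates for row `r` are the columns not used by the rows above index `r`,
    -- where all of `S` agrees with `π₀`.
    obtain ⟨t, ht, he⟩ := key k ((Finset.Iic r).image π₀) S subset_rfl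
      (by rw [Finset.card_image_of_injective _ π₀.injective, Fin.card_Iic]) (fun π hπ => by
        refine Finset.mem_image.2 ⟨π₀.symm (π r), ?_, by simp⟩
        rw [Finset.mem_Iic]
        by_contra! hlt
        have h1 := hS π hπ π₀ h₀ (π₀.symm (π r)) hlt
        rw [Equiv.apply_symm_apply] at h1
        exact hlt.ne' (π.injective h1))
    refine ⟨t, ht.trans (le_of_eq ?_), he⟩
    rw [← Finset.sum_range_id_mul_two, ← Finset.sum_range_id_mul_two,
      Nat.mul_div_cancel _ two_pos, Nat.mul_div_cancel _ two_pos, Finset.sum_range_succ]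

/-- If `π` is the only permutation avoiding `Z`, then `Z` has at least `n.choose 2` elements. -/
theorem choose_two_le_card_of_unique {n : ℕ} (Z : Finset (Fin n × Fin n))
    (π : Equiv.Perm (Fin n))
    (hu : ∀ ρ : Equiv.Perm (Fin n), (∀ i, (i, ρ i) ∉ Z) → ρ = π) (hπ : ∀ i, (i, π i) ∉ Z) :
    n * (n - 1) / 2 ≤ Z.card := by
  have key : ∀ a b : Fin n, a ≠ b → (a, π b) ∈ Z ∨ (b, π a) ∈ Z := by
    intro a b hab
    by_contra! h
    have := hu (π * Equiv.swap a b) fun i => by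
      rw [Equiv.Perm.mul_apply]
      rcases eq_or_ne i a with rfl | hia
      · simpa using h.1
      rcases eq_or_ne i b with rfl | hib
      · simpa using h.2
      · rw [Equiv.swap_apply_of_ne_of_ne hia hib]
        exact hπ i
    have h2 : π (Equiv.swap a b a) = π a := by rw [← Equiv.Perm.mul_apply, this]
    rw [Equiv.swap_apply_left] at h2
    exact hab (π.injective h2).symm
  have hc : n.choose 2 = (Finset.powersetCard 2 (Finset.univ : Finset (Fin n))).card := by simp
  rw [← Nat.choose_two_right, hc]
  -- A zero at `p` can only serve the pair `{p.1, π.symm p.2}`, so distinct pairs use distinct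
  -- zeros.
  have hsub : Finset.powersetCard 2 (Finset.univ : Finset (Fin n)) ⊆
      Z.image fun p => {p.1, π.symm p.2} := by
    intro s hs
    obtain ⟨a, b, hab, rfl⟩ := Finset.card_eq_two.1 (Finset.mem_powersetCard.1 hs).2
    rw [Finset.mem_image]
    rcases key a b hab with h | h
    · exact ⟨_, h, by simp⟩
    · exact ⟨_, h, by simp [Finset.pair_comm]⟩
  exact (Finset.card_le_card hsub).trans Finset.card_image_le

/-- The adversary that answers `0` as long as some permutation is still possible. -/
theorem DecisionTree.exists_adversary {n : ℕ} {R : Type v} (t : DecisionTree (Fin n × Fin n) R)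
    (Z : Finset (Fin n × Fin n)) (hZ : ∃ π : Equiv.Perm (Fin n), ∀ i, (i, π i) ∉ Z) :
    ∃ (Z' : Finset (Fin n × Fin n)) (π : Equiv.Perm (Fin n)), Z ⊆ Z' ∧
      Z'.card ≤ Z.card + t.depth ∧ (∀ i, (i, π i) ∉ Z') ∧
      ∀ ρ : Equiv.Perm (Fin n), (∀ i, (i, ρ i) ∉ Z') →
        t.eval (permBits ρ) = t.eval (permBits π) := by
  induction t generalizing Z with
  | leaf r =>
    obtain ⟨π, hπ⟩ := hZ
    exact ⟨Z, π, subset_rfl, by simp, hπ, fun _ _ => rfl⟩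
  | node e t₀ t₁ ih₀ ih₁ =>
    by_cases he : ∃ π : Equiv.Perm (Fin n), ∀ i, (i, π i) ∉ insert e Z
    · obtain ⟨Z', π, hs, hc, hπ, hu⟩ := ih₀ _ he
      have hav : ∀ ρ : Equiv.Perm (Fin n), (∀ i, (i, ρ i) ∉ Z') → ¬ permBits ρ e = true := by
        intro ρ hρ h
        rw [permBits_eq_true] at h
        refine hρ e.1 (hs ?_)
        rw [h]
        exact Finset.mem_insert_self _ _
      refine ⟨Z', π, (Finset.subset_insert _ _).trans hs, ?_, hπ, fun ρ hρ => ?_⟩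
      · have := Finset.card_insert_le e Z
        simp only [DecisionTree.depth]
        omega
      · simp only [DecisionTree.eval, hav ρ hρ, hav π hπ]
        exact hu ρ hρ
    -- Here the answer `1` is already forced by `Z`, so it need not be recorded.
    · obtain ⟨Z', π, hs, hc, hπ, hu⟩ := ih₁ Z hZ
      have hav : ∀ ρ : Equiv.Perm (Fin n), (∀ i, (i, ρ i) ∉ Z') → permBits ρ e = true := by
        intro ρ hρ
        by_contra h
        rw [permBits_eq_true] at h
        refine he ⟨ρ, fun i hi => ?_⟩
        rcases Finset.mem_insert.1 hi with h' | h'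
        · exact h (by rw [← h'])
        · exact hρ i (hs h')
      refine ⟨Z', π, hs, ?_, hπ, fun ρ hρ => ?_⟩
      · simp only [DecisionTree.depth]
        omega
      · simp only [DecisionTree.eval, hav ρ hρ, hav π hπ]
        exact hu ρ hρ

theorem exists_decisionTree_matching (n : ℕ) :
    ∃ t : DecisionTree (Fin n × Fin n) (matchingMatrices n),
      t.Computes (id : matchingMatrices n → matchingMatrices n) ∧ t.depth ≤ n * (n - 1) / 2 := by
  obtain ⟨t, hd, he⟩ := DecisionTree.exists_of_agree n le_rfl Finset.univ
    fun _ _ _ _ i hi => absurd i.2 (by omega)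
  refine ⟨t, fun x => ?_, hd⟩
  obtain ⟨π, rfl⟩ := (permEquivMatching n).surjective x
  exact he π (Finset.mem_univ _)

theorem learnD_matching (n : ℕ) :
    learnD (matchingMatrices n) = ((n * (n - 1) / 2 : ℕ) : ℕ∞) := by
  apply le_antisymm
  · obtain ⟨t, ht, hd⟩ := exists_decisionTree_matching n
    exact (iInf₂_le t ht).trans (Nat.cast_le.2 hd)
  · refine le_iInf₂ fun t ht => Nat.cast_le.2 ?_
    obtain ⟨Z, π, -, hc, hπ, hu⟩ := t.exists_adversary ∅ ⟨1, by simp⟩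
    refine (choose_two_le_card_of_unique Z π (fun ρ hρ => ?_) hπ).trans (by simpa using hc)
    have h := hu ρ hρ
    have e : ∀ σ, t.eval (permBits σ) = permEquivMatching n σ :=
      fun σ => ht (permEquivMatching n σ)
    rw [e, e] at h
    exact (permEquivMatching n).injective h

/-! ### Randomized query complexity -/

/-- A tree distinguishes few inputs of small Hamming weight. -/
theorem DecisionTree.card_mul_pow_le {ι : Type u} [Fintype ι] [DecidableEq ι] {R : Type v}
    (t : DecisionTree ι R) (n : ℕ) {y : ℝ} (hy : 0 ≤ y) (hy1 : y ≤ 1) (O : Finset ι)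
    (S : Finset (ι → Bool)) (hO : ∀ x ∈ S, ∀ i ∈ O, x i = true)
    (hn : ∀ x ∈ S, (Finset.univ.filter fun i => x i = true).card ≤ n)
    (hinj : Set.InjOn t.eval S) :
    (S.card : ℝ) * y ^ n ≤ (1 + y) ^ t.depth * y ^ O.card := by
  -- `O` holds the positions already answered `1`. Giving each leaf the weight `y` to the number of
  -- ones on its path, a query splits the total into a factor at most `1 + y`.
  induction t generalizing O S with
  | leaf r =>
    rcases S.eq_empty_or_nonempty with rfl | ⟨x, hx⟩
    · simpa [DecisionTree.depth] using pow_nonneg hy _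
    have h1 : (S.card : ℝ) ≤ 1 := by
      exact_mod_cast Finset.card_le_one.2 fun a ha b hb => hinj ha hb rfl
    have h2 : O.card ≤ n := (Finset.card_le_card fun i hi => by simp [hO x hx i hi]).trans (hn x hx)
    calc (S.card : ℝ) * y ^ n ≤ 1 * y ^ O.card :=
          mul_le_mul h1 (pow_le_pow_of_le_one hy hy1 h2) (pow_nonneg hy _) zero_le_one
      _ = _ := by simp [DecisionTree.depth]
  | node i t₀ t₁ ih₀ ih₁ =>
    have e₀ := ih₀ O (S.filter fun x => ¬ x i = true)
      (fun x hx => hO x (Finset.mem_filter.1 hx).1) (fun x hx => hn x (Finset.mem_filter.1 hx).1)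
      (fun a ha b hb hab => by
        have ha' := Finset.mem_filter.1 (Finset.mem_coe.1 ha)
        have hb' := Finset.mem_filter.1 (Finset.mem_coe.1 hb)
        exact hinj ha'.1 hb'.1 (by simpa only [DecisionTree.eval, if_neg ha'.2, if_neg hb'.2]))
    have e₁ := ih₁ (insert i O) (S.filter fun x => x i = true)
      (fun x hx j hj => by
        rw [Finset.mem_filter] at hx
        rcases Finset.mem_insert.1 hj with rfl | hj
        exacts [hx.2, hO x hx.1 j hj])
      (fun x hx => hn x (Finset.mem_filter.1 hx).1)
      (fun a ha b hb hab => by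
        have ha' := Finset.mem_filter.1 (Finset.mem_coe.1 ha)
        have hb' := Finset.mem_filter.1 (Finset.mem_coe.1 hb)
        exact hinj ha'.1 hb'.1 (by simpa only [DecisionTree.eval, if_pos ha'.2, if_pos hb'.2]))
    have hcard := S.card_filter_add_card_filter_not (fun x => x i = true)
    have hcard' : (S.card : ℝ) = ((S.filter fun x => x i = true).card : ℝ) +
      ((S.filter fun x => ¬ x i = true).card : ℝ) := by exact_mod_cast hcard.symm
    set d := max t₀.depth t₁.depth with hd
    have m₀ : (1 + y) ^ t₀.depth ≤ (1 + y) ^ d :=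
      pow_le_pow_right₀ (by linarith) (le_max_left _ _)
    have m₁ : (1 + y) ^ t₁.depth ≤ (1 + y) ^ d :=
      pow_le_pow_right₀ (by linarith) (le_max_right _ _)
    have hdep : (DecisionTree.node i t₀ t₁).depth = d + 1 := rfl
    have hyO : 0 ≤ y ^ O.card := pow_nonneg hy _
    have hyO' : 0 ≤ y ^ (O.card + 1) := pow_nonneg hy _
    have hpos : 0 ≤ (1 + y) ^ d := by positivity
    rw [hdep, hcard', add_mul, pow_succ]
    -- A repeated query of a known one has an empty `0`-branch and adds nothing to `O`.
    by_cases hi : i ∈ O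
    · have hemp : (S.filter fun x => ¬ x i = true) = ∅ :=
        Finset.filter_eq_empty_iff.2 fun x hx => by simp [hO x hx i hi]
      rw [Finset.insert_eq_of_mem hi] at e₁
      rw [hemp]
      have := mul_le_mul_of_nonneg_right m₁ hyO
      have := mul_nonneg (mul_nonneg hpos hy) hyO
      simp only [Finset.card_empty, Nat.cast_zero, zero_mul, add_zero]
      nlinarith
    · rw [Finset.card_insert_of_notMem hi] at e₁
      have h1 := mul_le_mul_of_nonneg_right m₁ hyO'
      have h0 := mul_le_mul_of_nonneg_right m₀ hyO
      rw [pow_succ] at h1 e₁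
      nlinarith

open Classical in
/-- Averaging over the inputs. -/
theorem RandomizedDecisionTree.two_mul_card_le {ι : Type u} {R : Type v}
    {D : Set (ι → Bool)} [Fintype D] {f : D → R} {μ : RandomizedDecisionTree ι R}
    (hμ : RandomizedDecisionTree.Computes μ f) (K : ℕ)
    (hK : ∀ t ∈ μ.support, ∀ S : Finset D, (∀ x ∈ S, f x = t.eval x) → S.card ≤ K) :
    2 * Fintype.card D ≤ 3 * K := by
  have h1 : ∑ x : D, (2 / 3 : ENNReal) ≤ ∑ x : D, RandomizedDecisionTree.outputProb μ x (f x) :=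
    Finset.sum_le_sum fun x _ => hμ x
  have h2 : ∑ x : D, RandomizedDecisionTree.outputProb μ x (f x) ≤ K := by
    simp only [RandomizedDecisionTree.outputProb, PMF.map_apply]
    rw [← Summable.tsum_finsetSum fun _ _ => ENNReal.summable]
    calc ∑' t, ∑ x : D, (if f x = DecisionTree.eval t x then μ t else 0)
        ≤ ∑' t, μ t * K := ENNReal.tsum_le_tsum fun t => ?_
      _ = K := by rw [ENNReal.tsum_mul_right, μ.tsum_coe, one_mul]
    rw [← Finset.sum_filter, Finset.sum_const, nsmul_eq_mul, mul_comm]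
    by_cases ht : t ∈ μ.support
    · gcongr
      exact hK t ht _ fun x hx => (Finset.mem_filter.1 hx).2
    · simp [(PMF.apply_eq_zero_iff μ t).2 ht]
  have h3 := h1.trans h2
  rw [Finset.sum_const, nsmul_eq_mul, Finset.card_univ, ← mul_div_assoc] at h3
  have h4 := (ENNReal.div_le_iff_le_mul (by simp) (by simp)).1 h3
  have h5 : Fintype.card D * 2 ≤ K * 3 := by exact_mod_cast h4
  omega

theorem learnR_le_learnD {n : ℕ} (𝒢 : Set (BipartiteMatrix n)) : learnR 𝒢 ≤ learnD 𝒢 := by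
  refine le_iInf₂ fun t ht => (iInf₂_le (PMF.pure t) fun x => ?_).trans ?_
  · rw [RandomizedDecisionTree.outputProb, PMF.pure_map, ht x, PMF.pure_apply, if_pos rfl]
    exact ENNReal.div_le_of_le_mul (by norm_num)
  · refine iSup₂_le fun s hs => ?_
    rw [PMF.support_pure, Set.mem_singleton_iff] at hs
    rw [hs]

/-- With `y = 6 / n`, the weighted leaf count and `n ^ n ≤ n! * e ^ n` give at most `n! * (e * e ^
(6 / 25) / 6) ^ n` inputs. The base is at most `3 / 5`, which is below the required success rate `2
/ 3`; `6 ≤ n` ensures `y ≤ 1`. -/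
theorem depth_lower_bound {n : ℕ} (hn : 6 ≤ n)
    (t : DecisionTree (Fin n × Fin n) (matchingMatrices n)) (S : Finset (BipartiteMatrix n))
    (hw : ∀ x ∈ S, (Finset.univ.filter fun i => x i = true).card ≤ n)
    (hinj : Set.InjOn t.eval S) (hd : (t.depth : ℝ) ≤ (n : ℝ) ^ 2 / 25) :
    (S.card : ℝ) ≤ 3 / 5 * n.factorial := by
  have hn0 : (0 : ℝ) < n := by exact_mod_cast (by omega : 0 < n)
  have hn6 : (6 : ℝ) ≤ n := by exact_mod_cast hn
  have h := t.card_mul_pow_le n (y := 6 / n) (by positivity) ((div_le_one hn0).2 hn6) ∅ S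
    (by simp) hw hinj
  rw [Finset.card_empty, pow_zero, mul_one] at h
  have h1 : (1 + 6 / (n : ℝ)) ^ t.depth ≤ Real.exp (6 / 25) ^ n := by
    calc (1 + 6 / (n : ℝ)) ^ t.depth ≤ Real.exp (6 / n) ^ t.depth :=
          pow_le_pow_left₀ (by positivity) (by linarith [Real.add_one_le_exp (6 / (n : ℝ))]) _
      _ = Real.exp (t.depth * (6 / n)) := (Real.exp_nat_mul _ _).symm
      _ ≤ Real.exp (n * (6 / 25)) := by
          apply Real.exp_le_exp.2
          calc (t.depth : ℝ) * (6 / n) ≤ (n : ℝ) ^ 2 / 25 * (6 / n) := by gcongr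
            _ = n * (6 / 25) := by field_simp
      _ = _ := Real.exp_nat_mul _ _
  have h2 : (n : ℝ) ^ n ≤ n.factorial * Real.exp 1 ^ n := by
    have := Real.pow_div_factorial_le_exp (n : ℝ) hn0.le n
    rw [div_le_iff₀ (by positivity)] at this
    rw [← Real.exp_nat_mul, mul_one]
    linarith
  have h3 : Real.exp 1 * Real.exp (6 / 25) ≤ 18 / 5 := by
    have a := Real.exp_one_lt_d9
    have b : Real.exp (6 / 25) ≤ 25 / 19 := by
      have := Real.add_one_le_exp (-(6 / 25) : ℝ)
      rw [Real.exp_neg] at this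
      have h' : (19 / 25 : ℝ) ≤ (Real.exp (6 / 25))⁻¹ := by linarith
      rw [le_inv_comm₀ (by norm_num) (Real.exp_pos _)] at h'
      linarith
    have := Real.exp_pos (6 / 25)
    nlinarith [Real.exp_pos 1]
  have h4 : (S.card : ℝ) * 6 ^ n ≤ n.factorial * (18 / 5) ^ n := by
    rw [div_pow, ← mul_div_assoc, div_le_iff₀ (by positivity)] at h
    calc (S.card : ℝ) * 6 ^ n ≤ Real.exp (6 / 25) ^ n * (n.factorial * Real.exp 1 ^ n) :=
          h.trans (mul_le_mul h1 h2 (by positivity) (by positivity))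
      _ = n.factorial * (Real.exp 1 * Real.exp (6 / 25)) ^ n := by rw [mul_pow]; ring
      _ ≤ _ := by gcongr
  have h5 : (18 / 5 : ℝ) ^ n ≤ 3 / 5 * 6 ^ n := by
    have : (18 / 5 : ℝ) ^ n = (3 / 5) ^ n * 6 ^ n := by rw [← mul_pow]; norm_num
    rw [this]
    gcongr
    exact pow_le_of_le_one (by norm_num) (by norm_num) (by omega)
  have h6 : (S.card : ℝ) * 6 ^ n ≤ (3 / 5 * n.factorial) * 6 ^ n := by
    have := mul_le_mul_of_nonneg_left h5 (Nat.cast_nonneg (α := ℝ) n.factorial)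
    linarith
  exact le_of_mul_le_mul_right h6 (by positivity)

theorem le_learnR_matching {n : ℕ} (hn : 2 ≤ n) :
    ((⌈(n : ℝ) ^ 2 / 25⌉₊ : ℕ) : ℕ∞) ≤ learnR (matchingMatrices n) := by
  refine le_iInf₂ fun μ hμ => ?_
  by_contra! hlt
  have hdep : ∀ t ∈ μ.support, t.depth < ⌈(n : ℝ) ^ 2 / 25⌉₊ := fun t ht =>
    Nat.cast_lt.1 ((le_iSup₂ (f := fun (t : DecisionTree (Fin n × Fin n) (matchingMatrices n))
      (_ : t ∈ μ.support) => (t.depth : ℕ∞)) t ht).trans_lt hlt)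
  have : Fintype (matchingMatrices n) := Fintype.ofFinite _
  have hN : Fintype.card (matchingMatrices n) = n.factorial := by
    rw [← Fintype.card_congr (permEquivMatching n), Fintype.card_perm, Fintype.card_fin]
  rcases le_or_gt 6 n with h6 | h6
  · have h := RandomizedDecisionTree.two_mul_card_le hμ ⌊(3 / 5 * n.factorial : ℝ)⌋₊
      (fun t ht S hS => by
        apply Nat.le_floor
        rw [← Finset.card_map (Function.Embedding.subtype _)]
        refine depth_lower_bound h6 t _ ?_ ?_ (Nat.lt_ceil.1 (hdep t ht)).le
        · intro x hx
          obtain ⟨y, -, rfl⟩ := Finset.mem_map.1 hx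
          obtain ⟨π, rfl⟩ := (permEquivMatching n).surjective y
          exact (card_filter_permBits π).le
        · intro a ha b hb hab
          obtain ⟨a', ha', rfl⟩ := Finset.mem_map.1 (Finset.mem_coe.1 ha)
          obtain ⟨b', hb', rfl⟩ := Finset.mem_map.1 (Finset.mem_coe.1 hb)
          have hab' : t.eval (a' : BipartiteMatrix n) = t.eval (b' : BipartiteMatrix n) := hab
          rw [← hS a' ha', ← hS b' hb'] at hab'
          exact congrArg Subtype.val hab')
    rw [hN] at h
    have h1 : (2 * n.factorial : ℝ) ≤ 3 * ⌊(3 / 5 * n.factorial : ℝ)⌋₊ := by exact_mod_cast h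
    have h2 : (⌊(3 / 5 * n.factorial : ℝ)⌋₊ : ℝ) ≤ 3 / 5 * n.factorial :=
      Nat.floor_le (by positivity)
    have h3 : (0 : ℝ) < n.factorial := by positivity
    linarith
  -- For `n < 6` the claimed bound is a single query, and a tree without queries is correct on at
  -- most one of at least two inputs.
  · have h0 : ∀ t ∈ μ.support, t.depth = 0 := fun t ht => by
      have h1 : ⌈(n : ℝ) ^ 2 / 25⌉₊ ≤ 1 := by
        rw [Nat.ceil_le, Nat.cast_one, div_le_one (by norm_num)]
        have : n ^ 2 ≤ 25 := by nlinarith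
        exact_mod_cast this
      have := hdep t ht
      omega
    have h := RandomizedDecisionTree.two_mul_card_le hμ 1 (fun t ht S hS => by
      have := h0 t ht
      cases t with
      | leaf r =>
        exact Finset.card_le_one.2 fun a ha b hb => (hS a ha).trans (hS b hb).symm
      | node _ _ _ => simp [DecisionTree.depth] at this)
    rw [hN] at h
    have := Nat.factorial_le hn
    rw [Nat.factorial_two] at this
    omega

/-! ### Quantum query lower bound -/

section UnitaryInvariance

variable {κ : Type*} [Fintype κ]

theorem star_dotProduct_self (v : κ → ℂ) : star v ⬝ᵥ v = ((∑ k, ‖v k‖ ^ 2 : ℝ) : ℂ) := by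
  simp only [dotProduct, Pi.star_apply, RCLike.star_def, Complex.ofReal_sum]
  refine Finset.sum_congr rfl fun k _ => ?_
  rw [Complex.conj_mul']
  simp

variable [DecidableEq κ]

theorem star_mulVec_dotProduct_mulVec (U : Matrix.unitaryGroup κ ℂ) (v w : κ → ℂ) :
    star ((U : Matrix κ κ ℂ).mulVec v) ⬝ᵥ (U : Matrix κ κ ℂ).mulVec w = star v ⬝ᵥ w := by
  have h : star (U : Matrix κ κ ℂ) * (U : Matrix κ κ ℂ) = 1 := Matrix.UnitaryGroup.star_mul_self U
  rw [Matrix.star_mulVec, Matrix.dotProduct_mulVec, Matrix.vecMul_vecMul,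
    ← Matrix.star_eq_conjTranspose, h, Matrix.vecMul_one]

theorem sum_norm_sq_mulVec (U : Matrix.unitaryGroup κ ℂ) (v : κ → ℂ) :
    ∑ k, ‖(U : Matrix κ κ ℂ).mulVec v k‖ ^ 2 = ∑ k, ‖v k‖ ^ 2 := by
  have h := star_mulVec_dotProduct_mulVec U v v
  rw [star_dotProduct_self, star_dotProduct_self] at h
  exact_mod_cast h

theorem sum_norm_sq_mulVec_sub (U : Matrix.unitaryGroup κ ℂ) (v w : κ → ℂ) :
    ∑ k, ‖(U : Matrix κ κ ℂ).mulVec v k - (U : Matrix κ κ ℂ).mulVec w k‖ ^ 2 =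
      ∑ k, ‖v k - w k‖ ^ 2 := by
  have h := sum_norm_sq_mulVec U (v - w)
  rw [Matrix.mulVec_sub] at h
  exact h

end UnitaryInvariance

/-! ### Effect of one query on the distance of two states. -/

section Query

variable {ι : Type u} {w : ℕ}

/-- The weight of the part of the state that queries the bit `i`. -/
noncomputable def queryWeight (v : QBasis ι w → ℂ) (i : ι) : ℝ :=
  ∑ q : Bool × Fin w, ‖v (i, q)‖ ^ 2

theorem queryWeight_nonneg (v : QBasis ι w → ℂ) (i : ι) : 0 ≤ queryWeight v i :=
  Finset.sum_nonneg fun _ _ => by positivity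

variable [Fintype ι]

theorem sum_queryWeight (v : QBasis ι w → ℂ) :
    ∑ i, queryWeight v i = ∑ k, ‖v k‖ ^ 2 := by
  rw [Fintype.sum_prod_type]
  rfl

variable [DecidableEq ι]

theorem queryMatrix_mulVec (x : ι → Bool) (v : QBasis ι w → ℂ) (p : QBasis ι w) :
    (queryMatrix w x).mulVec v p = v (p.1, xor p.2.1 (x p.1), p.2.2) := by
  have h : ∀ q : QBasis ι w, p = (q.1, xor q.2.1 (x q.1), q.2.2) ↔
      q = (p.1, xor p.2.1 (x p.1), p.2.2) := by
    rintro ⟨i, b, z⟩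
    obtain ⟨i', b', z'⟩ := p
    simp only [Prod.mk.injEq]
    constructor <;> (rintro ⟨rfl, rfl, rfl⟩; simp)
  simp [Matrix.mulVec, dotProduct, queryMatrix, h]

theorem queryWeight_queryMatrix_mulVec (x : ι → Bool) (v : QBasis ι w → ℂ) (i : ι) :
    queryWeight ((queryMatrix w x).mulVec v) i = queryWeight v i := by
  simp only [queryWeight, queryMatrix_mulVec, Fintype.sum_prod_type, Fintype.sum_bool]
  cases x i <;> simp [add_comm]

theorem sum_norm_sq_queryMatrix_mulVec (x : ι → Bool) (v : QBasis ι w → ℂ) :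
    ∑ k, ‖(queryMatrix w x).mulVec v k‖ ^ 2 = ∑ k, ‖v k‖ ^ 2 := by
  simp only [← sum_queryWeight, queryWeight_queryMatrix_mulVec]

/-- The difference on the left is the cross term, at most `2 * ‖a‖ * ‖b‖`; weighted AM-GM splits it.
-/
theorem abs_norm_sub_sq_sub_le (a b : ℂ) {c : ℝ} (hc : 0 < c) :
    |‖a - b‖ ^ 2 - (‖a‖ ^ 2 + ‖b‖ ^ 2)| ≤ c * ‖a‖ ^ 2 + c⁻¹ * ‖b‖ ^ 2 := by
  have h1 : ‖a - b‖ ≤ ‖a‖ + ‖b‖ := norm_sub_le a b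
  have h2 : |‖a‖ - ‖b‖| ≤ ‖a - b‖ := abs_norm_sub_norm_le a b
  have h3 : 2 * (‖a‖ * ‖b‖) ≤ c * ‖a‖ ^ 2 + c⁻¹ * ‖b‖ ^ 2 := by
    have h := mul_nonneg (inv_nonneg.2 hc.le) (sq_nonneg (c * ‖a‖ - ‖b‖))
    have h' : c⁻¹ * (c * ‖a‖ - ‖b‖) ^ 2 =
        c * ‖a‖ ^ 2 + c⁻¹ * ‖b‖ ^ 2 - 2 * (‖a‖ * ‖b‖) := by
      field_simp
      ring
    linarith
  have h4 : (‖a‖ - ‖b‖) ^ 2 ≤ ‖a - b‖ ^ 2 := sq_le_sq' (by linarith [neg_abs_le (‖a‖ - ‖b‖)])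
    ((le_abs_self _).trans h2)
  have h5 : ‖a - b‖ ^ 2 ≤ (‖a‖ + ‖b‖) ^ 2 := pow_le_pow_left₀ (norm_nonneg _) h1 2
  rw [abs_le]
  constructor <;> nlinarith

/-- The weight `c` for a bit `1` and `c⁻¹` for a bit `0`. -/
noncomputable def bitWeight (c : ℝ) (b : Bool) : ℝ := if b then c else c⁻¹

/-- Where the bits agree the query acts on both states as the same permutation. Where they differ it
preserves both weights, so only the cross term changes; the factor `2` pays for it before and after
the query. The two bit weights are then reciprocal, as weighted AM-GM requires. -/
theorem query_block_le {c : ℝ} (hc : 0 < c) (x y : ι → Bool) (v v' : QBasis ι w → ℂ) (i : ι) :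
    ∑ q, ‖(queryMatrix w x).mulVec v (i, q) - (queryMatrix w y).mulVec v' (i, q)‖ ^ 2 ≤
      ∑ q, ‖v (i, q) - v' (i, q)‖ ^ 2 + if x i = y i then 0 else
        2 * (bitWeight c (x i) * queryWeight v i + bitWeight c (y i) * queryWeight v' i) := by
  split_ifs with h
  · simp only [queryMatrix_mulVec, Fintype.sum_prod_type, Fintype.sum_bool, h]
    cases y i <;> simp [add_comm]
  · have hw : bitWeight c (y i) = (bitWeight c (x i))⁻¹ := by
      cases hx : x i <;> cases hy : y i <;> simp_all [bitWeight]
    have hpos : 0 < bitWeight c (x i) := by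
      unfold bitWeight
      split_ifs <;> positivity
    rw [hw]
    generalize bitWeight c (x i) = d at hpos
    have bound : ∀ u u' : QBasis ι w → ℂ,
        |∑ q, ‖u (i, q) - u' (i, q)‖ ^ 2 - (queryWeight u i + queryWeight u' i)| ≤
          d * queryWeight u i + d⁻¹ * queryWeight u' i := by
      intro u u'
      simp only [queryWeight, Finset.mul_sum, ← Finset.sum_add_distrib, ← Finset.sum_sub_distrib]
      exact (Finset.abs_sum_le_sum_abs _ _).trans
        (Finset.sum_le_sum fun q _ => abs_norm_sub_sq_sub_le _ _ hpos)
    have h1 := (abs_le.1 (bound ((queryMatrix w x).mulVec v) ((queryMatrix w y).mulVec v'))).2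
    have h2 := (abs_le.1 (bound v v')).1
    rw [queryWeight_queryMatrix_mulVec, queryWeight_queryMatrix_mulVec] at h1
    linarith

theorem query_dist_le {c : ℝ} (hc : 0 < c) (x y : ι → Bool) (v v' : QBasis ι w → ℂ) :
    ∑ k, ‖(queryMatrix w x).mulVec v k - (queryMatrix w y).mulVec v' k‖ ^ 2 ≤
      ∑ k, ‖v k - v' k‖ ^ 2 + ∑ i, if x i = y i then 0 else
        2 * (bitWeight c (x i) * queryWeight v i + bitWeight c (y i) * queryWeight v' i) := by
  rw [Fintype.sum_prod_type, Fintype.sum_prod_type (f := fun k => ‖v k - v' k‖ ^ 2),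
    ← Finset.sum_add_distrib]
  exact Finset.sum_le_sum fun i _ => query_block_le hc x y v v' i

end Query

/-! ### The adversary method for quantum algorithms. -/

namespace QuantumQueryAlgorithm

variable {ι : Type u} [Fintype ι] [DecidableEq ι] {R : Type v} (A : QuantumQueryAlgorithm ι R)

theorem sum_norm_sq_state (x : ι → Bool) (t : ℕ) : ∑ k, ‖A.state x t k‖ ^ 2 = 1 := by
  induction t with
  | zero => rw [state, sum_norm_sq_mulVec, A.norm_init]
  | succ t ih => rw [state, sum_norm_sq_mulVec, sum_norm_sq_queryMatrix_mulVec, ih]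

/-- The squared distance of the states on two inputs. -/
noncomputable def stateDist (x y : ι → Bool) (t : ℕ) : ℝ :=
  ∑ k, ‖A.state x t k - A.state y t k‖ ^ 2

theorem stateDist_zero (x y : ι → Bool) : A.stateDist x y 0 = 0 := by
  simp [stateDist, state]

theorem stateDist_succ_le {c : ℝ} (hc : 0 < c) (x y : ι → Bool) (t : ℕ) :
    A.stateDist x y (t + 1) ≤ A.stateDist x y t + ∑ i, if x i = y i then 0 else
      2 * (bitWeight c (x i) * queryWeight (A.state x t) i +
        bitWeight c (y i) * queryWeight (A.state y t) i) := by
  simp only [stateDist, state, sum_norm_sq_mulVec_sub]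
  exact query_dist_le hc x y _ _

/-- From `(a + b) ^ 2 ≤ 3 / 2 * a ^ 2 + 3 * b ^ 2`: the probability of `r` falls from at least `2 /
3` to at most `1 / 3`, so three times the distance is at least `2 / 3 - 1 / 2`. -/
theorem le_stateDist_of_outputProb {x y : ι → Bool} {r s : R} (hrs : r ≠ s)
    (hx : 2 / 3 ≤ A.outputProb x r) (hy : 2 / 3 ≤ A.outputProb y s) :
    1 / 18 ≤ A.stateDist x y A.queries := by
  classical
  have hy' : A.outputProb y r ≤ 1 / 3 := by
    have h : A.outputProb y r + A.outputProb y s ≤ 1 := by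
      rw [← A.sum_norm_sq_state y A.queries, outputProb, outputProb, ← Finset.sum_add_distrib]
      refine Finset.sum_le_sum fun k _ => ?_
      by_cases hr : A.out k = r
      · have hs : A.out k ≠ s := fun h => hrs (hr.symm.trans h)
        simp [hr, hrs]
      · by_cases hs : A.out k = s
        · simp [hs, hrs.symm]
        · simp [hr, hs]
    linarith
  have h : A.outputProb x r ≤ 3 / 2 * A.outputProb y r + 3 * A.stateDist x y A.queries := by
    rw [outputProb, outputProb, stateDist, Finset.mul_sum, Finset.mul_sum,
      ← Finset.sum_add_distrib]
    refine Finset.sum_le_sum fun k _ => ?_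
    split_ifs
    · have h1 : ‖A.state x A.queries k‖ ≤
          ‖A.state y A.queries k‖ + ‖A.state x A.queries k - A.state y A.queries k‖ := by
        have := norm_add_le (A.state y A.queries k) (A.state x A.queries k - A.state y A.queries k)
        rwa [add_sub_cancel] at this
      have h2 := pow_le_pow_left₀ (norm_nonneg _) h1 2
      nlinarith [sq_nonneg (‖A.state y A.queries k‖ -
        2 * ‖A.state x A.queries k - A.state y A.queries k‖)]
    · positivity
  linarith

/-- The adversary bound for a family of involutions on the inputs. -/
theorem adversary_bound {X α : Type*} [Fintype X] (enc : X → ι → Bool) (K : Finset α)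
    (s : α → X → X) (hs : ∀ a x, s a (s a x) = x) {c B : ℝ} (hc : 0 < c)
    (hB : ∀ x i, bitWeight c (enc x i) *
      (K.filter fun a => enc x i ≠ enc (s a x) i).card ≤ B) (t : ℕ) :
    ∑ a ∈ K, ∑ x, A.stateDist (enc x) (enc (s a x)) t ≤ 4 * B * Fintype.card X * t := by
  induction t with
  | zero => simp [stateDist_zero]
  | succ t ih =>
    let g : X → ι → ℝ := fun x i => bitWeight c (enc x i) * queryWeight (A.state (enc x) t) i
    have half : ∑ a ∈ K, ∑ x, ∑ i, (if enc x i = enc (s a x) i then 0 else g x i) ≤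
        B * Fintype.card X := by
      rw [Finset.sum_comm]
      calc ∑ x, ∑ a ∈ K, ∑ i, (if enc x i = enc (s a x) i then 0 else g x i)
          ≤ ∑ x : X, B * ∑ i, queryWeight (A.state (enc x) t) i := by
            refine Finset.sum_le_sum fun x _ => ?_
            rw [Finset.sum_comm, Finset.mul_sum]
            refine Finset.sum_le_sum fun i _ => ?_
            have e : ∑ a ∈ K, (if enc x i = enc (s a x) i then 0 else g x i) =
                (bitWeight c (enc x i) * (K.filter fun a => enc x i ≠ enc (s a x) i).card) *
                  queryWeight (A.state (enc x) t) i := by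
              simp only [← ite_not (p := enc x i = _)]
              rw [← Finset.sum_filter, Finset.sum_const, nsmul_eq_mul]
              ring
            rw [e]
            exact mul_le_mul_of_nonneg_right (hB x i) (queryWeight_nonneg _ _)
        _ = B * Fintype.card X := by
            simp [sum_queryWeight, sum_norm_sq_state, mul_comm]
    -- Substituting `s a x` for `x` turns the partner's share of the progress into that of `x`
    -- itself.
    have flip : ∑ a ∈ K, ∑ x, ∑ i, (if enc x i = enc (s a x) i then 0 else g (s a x) i) =
        ∑ a ∈ K, ∑ x, ∑ i, (if enc x i = enc (s a x) i then 0 else g x i) := by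
      refine Finset.sum_congr rfl fun a _ => ?_
      have hinv : Function.Involutive (s a) := hs a
      refine Fintype.sum_equiv hinv.toPerm _ _ fun x => ?_
      simp only [Function.Involutive.coe_toPerm, hs, @eq_comm _ (enc (s a x) _)]
    have step : ∑ a ∈ K, ∑ x, A.stateDist (enc x) (enc (s a x)) (t + 1) ≤
        ∑ a ∈ K, ∑ x, A.stateDist (enc x) (enc (s a x)) t +
        2 * (∑ a ∈ K, ∑ x, ∑ i, (if enc x i = enc (s a x) i then 0 else g x i) +
          ∑ a ∈ K, ∑ x, ∑ i, (if enc x i = enc (s a x) i then 0 else g (s a x) i)) := by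
      rw [← Finset.sum_add_distrib, Finset.mul_sum, ← Finset.sum_add_distrib]
      refine Finset.sum_le_sum fun a _ => ?_
      rw [← Finset.sum_add_distrib, Finset.mul_sum, ← Finset.sum_add_distrib]
      refine Finset.sum_le_sum fun x _ => ?_
      refine (A.stateDist_succ_le hc _ _ t).trans (le_of_eq ?_)
      rw [← Finset.sum_add_distrib, Finset.mul_sum]
      congr 1
      refine Finset.sum_congr rfl fun i _ => ?_
      split_ifs
      · simp
      · rfl
    rw [flip] at step
    push_cast
    linarith

end QuantumQueryAlgorithm

/-! ### The adversary bound for transpositions. -/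

/-- Removing the one in row `i` requires a swap that moves `i`; creating a one at `(i, j)` requires
exactly the swap of `i` with `π.symm j`. Pairs are ordered, hence the factors `2`. -/
theorem card_filter_permBits_ne_le {n : ℕ} (π : Equiv.Perm (Fin n)) (p : Fin n × Fin n) :
    ((Finset.univ : Finset (Fin n)).offDiag.filter fun a =>
      permBits π p ≠ permBits (π * Equiv.swap a.1 a.2) p).card ≤
        if permBits π p = true then 2 * n else 2 := by
  obtain ⟨i, j⟩ := p
  split_ifs with h
  · rw [permBits_eq_true] at h
    refine (Finset.card_le_card (t := Finset.univ.image (fun b => (i, b)) ∪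
      Finset.univ.image (fun b => (b, i))) fun a ha => ?_).trans
      ((Finset.card_union_le _ _).trans ?_)
    · have ha := (Finset.mem_filter.1 ha).2
      by_contra hn
      simp only [Finset.mem_union, Finset.mem_image, Finset.mem_univ, true_and, not_or,
        not_exists] at hn
      have h1 : i ≠ a.1 := fun e => hn.1 a.2 (by rw [e])
      have h2 : i ≠ a.2 := fun e => hn.2 a.1 (by rw [e])
      apply ha
      simp [permBits, Equiv.swap_apply_of_ne_of_ne h1 h2]
    · have h1 := Finset.card_image_le (s := Finset.univ) (f := fun b : Fin n => (i, b))
      have h2 := Finset.card_image_le (s := Finset.univ) (f := fun b : Fin n => (b, i))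
      rw [Finset.card_univ, Fintype.card_fin] at h1 h2
      omega
  · refine (Finset.card_le_card (t := {(i, π.symm j), (π.symm j, i)}) fun a ha => ?_).trans
      Finset.card_le_two
    have ha := (Finset.mem_filter.1 ha).2
    have h' : permBits (π * Equiv.swap a.1 a.2) (i, j) = true := by
      revert ha h
      cases permBits π (i, j) <;> simp
    rw [permBits_eq_true] at h h'
    simp only at h h'
    rw [Equiv.Perm.mul_apply, ← Equiv.eq_symm_apply] at h'
    have hne : i ≠ π.symm j := fun e => h (by rw [e, Equiv.apply_symm_apply])
    simp only [Finset.mem_insert, Finset.mem_singleton]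
    by_cases h1 : i = a.1
    · subst h1
      rw [Equiv.swap_apply_left] at h'
      exact Or.inl (Prod.ext rfl h')
    · by_cases h2 : i = a.2
      · subst h2
        rw [Equiv.swap_apply_right] at h'
        exact Or.inr (Prod.ext h' rfl)
      · rw [Equiv.swap_apply_of_ne_of_ne h1 h2] at h'
        exact absurd h' hne

theorem le_queries_of_computes_matching {n : ℕ} (hn : 2 ≤ n)
    (A : QuantumQueryAlgorithm (Fin n × Fin n) (matchingMatrices n))
    (hA : A.Computes (id : matchingMatrices n → matchingMatrices n)) :
    1 / 288 * (n : ℝ) ^ (3 / 2 : ℝ) ≤ A.queries := by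
  have hn2 : (2 : ℝ) ≤ n := by exact_mod_cast hn
  have hn0 : (0 : ℝ) < n := by linarith
  set r := √(n : ℝ) with hr
  have hr0 : 0 < r := Real.sqrt_pos.2 hn0
  have hrr : r * r = n := Real.mul_self_sqrt hn0.le
  have hB : ∀ (π : Equiv.Perm (Fin n)) (i : Fin n × Fin n), bitWeight r⁻¹ (permBits π i) *
      ((Finset.univ : Finset (Fin n)).offDiag.filter fun a =>
        permBits π i ≠ permBits (π * Equiv.swap a.1 a.2) i).card ≤ 2 * r := by
    intro π i
    have h := card_filter_permBits_ne_le π i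
    unfold bitWeight
    split_ifs at h ⊢ with hb
    · calc _ ≤ r⁻¹ * ((2 * n : ℕ) : ℝ) := by gcongr
        _ = 2 * r := by push_cast; rw [← hrr]; field_simp
    · calc _ ≤ r⁻¹⁻¹ * ((2 : ℕ) : ℝ) := by gcongr
        _ = 2 * r := by push_cast; rw [inv_inv]; ring
  -- The weight `r⁻¹` on ones balances `2 * n` against `2`: both products equal `2 * √n`.
  have hup := A.adversary_bound permBits (Finset.univ : Finset (Fin n)).offDiag
    (fun a π => π * Equiv.swap a.1 a.2) (fun a π => by simp [mul_assoc])
    (inv_pos.2 hr0) hB A.queries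
  have hlow : ∑ a ∈ (Finset.univ : Finset (Fin n)).offDiag, ∑ _π : Equiv.Perm (Fin n),
      (1 / 18 : ℝ) ≤ ∑ a ∈ (Finset.univ : Finset (Fin n)).offDiag, ∑ π : Equiv.Perm (Fin n),
        A.stateDist (permBits π) (permBits (π * Equiv.swap a.1 a.2)) A.queries := by
    refine Finset.sum_le_sum fun a ha => Finset.sum_le_sum fun π _ => ?_
    refine A.le_stateDist_of_outputProb (r := permEquivMatching n π)
      (s := permEquivMatching n (π * Equiv.swap a.1 a.2)) (fun h => ?_)
      (hA (permEquivMatching n π)) (hA (permEquivMatching n (π * Equiv.swap a.1 a.2)))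
    have h1 : Equiv.swap a.1 a.2 = 1 := by simpa using (permEquivMatching n).injective h
    exact (Finset.mem_offDiag.1 ha).2.2 (Equiv.swap_eq_one_iff.1 h1)
  have hall := hlow.trans hup
  rw [Finset.sum_const, Finset.sum_const, Finset.offDiag_card, nsmul_eq_mul, nsmul_eq_mul,
    Finset.card_univ, Finset.card_univ, Fintype.card_fin] at hall
  have hsub : ((n * n - n : ℕ) : ℝ) = n * n - n := by
    rw [Nat.cast_sub (Nat.le_mul_self n)]
    push_cast
    ring
  rw [hsub] at hall
  set N : ℝ := (Fintype.card (Equiv.Perm (Fin n)) : ℝ) with hN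
  have hN0 : 0 < N := by
    rw [hN]
    exact_mod_cast Fintype.card_pos
  have h1 : ((n : ℝ) * n - n) * (1 / 18) ≤ 8 * r * A.queries := by
    refine le_of_mul_le_mul_right ?_ hN0
    linarith
  -- For `2 ≤ n`, `n * n - n` is at least half of `n * n`, so `288 = 2 * 18 * 8`.
  have h2 : (n : ℝ) * n ≤ 288 * r * A.queries := by nlinarith
  have h3 : (n : ℝ) ^ (3 / 2 : ℝ) = n * r := by
    rw [show (3 / 2 : ℝ) = 1 + 1 / 2 by norm_num, Real.rpow_add hn0, Real.rpow_one,
      ← Real.sqrt_eq_rpow]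
  rw [h3]
  have h4 : r * (1 / 288 * (n * r)) ≤ r * A.queries := by
    have : r * (1 / 288 * (n * r)) = 1 / 288 * (n * n) := by rw [← hrr]; ring
    rw [this]
    linarith
  exact le_of_mul_le_mul_left h4 hr0

/-! ### Quantum query upper bound -/

/-- Two families of vectors with the same Gram matrix are related by a unitary. -/
theorem exists_unitary_of_gram_eq {κ X : Type*} [Fintype κ] [DecidableEq κ] (v w : X → κ → ℂ)
    (h : ∀ x y, star (v x) ⬝ᵥ v y = star (w x) ⬝ᵥ w y) :
    ∃ U : Matrix.unitaryGroup κ ℂ, ∀ x, (U : Matrix κ κ ℂ).mulVec (v x) = w x := by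
  let V : (X →₀ ℂ) →ₗ[ℂ] EuclideanSpace ℂ κ :=
    Finsupp.linearCombination ℂ fun x => WithLp.toLp 2 (v x)
  let W : (X →₀ ℂ) →ₗ[ℂ] EuclideanSpace ℂ κ :=
    Finsupp.linearCombination ℂ fun x => WithLp.toLp 2 (w x)
  have hinner : ∀ a, inner ℂ (V a) (V a) = inner ℂ (W a) (W a) := by
    intro a
    simp only [V, W, Finsupp.linearCombination_apply, Finsupp.sum_inner, Finsupp.inner_sum,
      EuclideanSpace.inner_eq_star_dotProduct, dotProduct_comm _ (star _), WithLp.ofLp_smul,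
      star_smul, dotProduct_smul, h]
  have hnorm : ∀ a, ‖V a‖ = ‖W a‖ := fun a => by
    rw [@norm_eq_sqrt_re_inner ℂ, @norm_eq_sqrt_re_inner ℂ, hinner]
  obtain ⟨g, hg⟩ := V.rangeRestrict.exists_rightInverse_of_surjective V.range_rangeRestrict
  have hVg : ∀ u, V (g u) = u := fun u => congrArg Subtype.val (LinearMap.congr_fun hg u)
  let L : LinearMap.range V →ₗᵢ[ℂ] EuclideanSpace ℂ κ :=
    ⟨W ∘ₗ g, fun u => by rw [LinearMap.comp_apply, ← hnorm, hVg]; rfl⟩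
  -- Equal norms put the kernel of `V` inside that of `W`, so the choice of preimage `g` does not
  -- matter.
  have hL : ∀ a, L (V.rangeRestrict a) = W a := fun a => by
    have h0 : ‖W (g (V.rangeRestrict a) - a)‖ = 0 := by
      rw [← hnorm, map_sub, hVg]
      simp
    rw [norm_eq_zero, map_sub, sub_eq_zero] at h0
    exact h0
  let T : EuclideanSpace ℂ κ ≃ₗᵢ[ℂ] EuclideanSpace ℂ κ := L.extend.toLinearIsometryEquiv rfl
  let u := Unitary.linearIsometryEquiv.symm T
  let M := (Matrix.toEuclideanCLM (n := κ) (𝕜 := ℂ)).symm (u : _ →L[ℂ] _)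
  have hM : M ∈ Matrix.unitaryGroup κ ℂ :=
    Unitary.map_mem (Matrix.toEuclideanCLM (n := κ) (𝕜 := ℂ)).symm u.2
  refine ⟨⟨M, hM⟩, fun x => ?_⟩
  have h1 : Matrix.toEuclideanCLM (n := κ) (𝕜 := ℂ) M (WithLp.toLp 2 (v x)) =
      WithLp.toLp 2 (w x) := by
    have h2 := hL (Finsupp.single x 1)
    rw [← LinearIsometry.extend_apply] at h2
    have hV : ((V.rangeRestrict (Finsupp.single x 1) : LinearMap.range V) :
        EuclideanSpace ℂ κ) = WithLp.toLp 2 (v x) := by simp [V]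
    have hW : W (Finsupp.single x 1) = WithLp.toLp 2 (w x) := by simp [W]
    rw [hV, hW] at h2
    rw [StarAlgEquiv.apply_symm_apply]
    exact h2
  rw [Matrix.toEuclideanCLM_toLp] at h1
  exact (WithLp.toLp_injective 2) h1

/-- It suffices to specify the states of an algorithm, if their Gram matrices fit. -/
theorem quantumQueryComplexity_le_of_states {ι : Type u} [Fintype ι] [DecidableEq ι] {R : Type v}
    {D : Set (ι → Bool)} (f : D → R) {w : ℕ} (T : ℕ) (ψ : ℕ → D → QBasis ι w → ℂ)
    (out : QBasis ι w → R) (v₀ : QBasis ι w → ℂ) (h₀ : ∀ x, ψ 0 x = v₀)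
    (hnorm : ∑ k, ‖v₀ k‖ ^ 2 = 1)
    (hstep : ∀ t < T, ∀ x y : D,
      star ((queryMatrix w x).mulVec (ψ t x)) ⬝ᵥ (queryMatrix w y).mulVec (ψ t y) =
        star (ψ (t + 1) x) ⬝ᵥ ψ (t + 1) y)
    (hout : ∀ x k, ψ T x k ≠ 0 → out k = f x) :
    quantumQueryComplexity f ≤ T := by
  classical
  have hU : ∀ t, ∃ U : Matrix.unitaryGroup (QBasis ι w) ℂ, t < T → ∀ x : D,
      (U : Matrix (QBasis ι w) (QBasis ι w) ℂ).mulVec ((queryMatrix w x).mulVec (ψ t x)) =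
        ψ (t + 1) x := by
    intro t
    by_cases ht : t < T
    · exact (exists_unitary_of_gram_eq _ _ (hstep t ht)).imp fun _ h _ => h
    · exact ⟨1, fun h => absurd h ht⟩
  choose U hU using hU
  let A : QuantumQueryAlgorithm ι R :=
    { w := w, queries := T, init := v₀, norm_init := hnorm, out := out
      U := fun t => Nat.casesOn t 1 U }
  have hstate : ∀ t ≤ T, ∀ x : D, A.state x t = ψ t x := by
    intro t
    induction t with
    | zero => exact fun _ x => by simp [QuantumQueryAlgorithm.state, A, h₀]
    | succ t ih =>
      intro ht x
      rw [QuantumQueryAlgorithm.state, ih (by omega) x]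
      exact hU t ht x
  refine iInf₂_le (i := A) (j := fun x => ?_)
  have h1 : A.outputProb x (f x) = 1 := by
    rw [← A.sum_norm_sq_state x A.queries, QuantumQueryAlgorithm.outputProb]
    refine Finset.sum_congr rfl fun k _ => ?_
    rw [ite_eq_left_iff]
    intro hk
    by_contra hne
    refine hk (hout x k ?_)
    rw [← hstate T le_rfl x]
    intro h0
    exact hne (by rw [show A.state x A.queries k = 0 from h0]; simp)
  rw [h1]
  norm_num

theorem sum_norm_sq_eq_one {κ : Type*} [Fintype κ] {v : κ → ℂ} (h : star v ⬝ᵥ v = 1) :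
    ∑ k, ‖v k‖ ^ 2 = 1 := by
  rw [star_dotProduct_self] at h
  exact_mod_cast h

/-- The amplitudes of a Grover state: `a` at the marked column `m`, and `b` elsewhere. -/
def groverAmplitude {n : ℕ} (m : Fin n) (a b : ℝ) (j : Fin n) : ℝ := if m = j then a else b

theorem sum_groverAmplitude_mul {n : ℕ} (m m' : Fin n) (a b : ℝ) :
    ∑ j, groverAmplitude m a b j * groverAmplitude m' a b j =
      if m = m' then a ^ 2 + (n - 1) * b ^ 2 else 2 * (a * b) + (n - 2) * b ^ 2 := by
  have e : ∀ j, groverAmplitude m a b j * groverAmplitude m' a b j = b ^ 2 +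
      (if m = j then (a - b) * b else 0) + (if m' = j then (a - b) * b else 0) +
      if m = j then if m = m' then (a - b) ^ 2 else 0 else 0 := by
    intro j
    unfold groverAmplitude
    by_cases h1 : m = j
    · by_cases h2 : m' = j
      · simp only [h1, h2, if_true]; ring
      · have : m ≠ m' := fun h => h2 (h ▸ h1)
        simp only [h1, h2, if_true, if_false]
        rw [if_neg (fun h => h2 h.symm)]
        ring
    · simp only [h1, if_false]
      split_ifs <;> ring
  simp only [e, Finset.sum_add_distrib, Finset.sum_ite_eq, Finset.mem_univ, if_true,
    Finset.sum_const, Finset.card_univ, Fintype.card_fin, nsmul_eq_mul]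
  split_ifs <;> ring

/-! ### Exact search in a row, described by its states. -/

section GroverStates

variable {n w : ℕ} [NeZero n]

/-- Amplitudes `g` on the queries in row `i` that pick up a phase, and `h` on one that does not,
with the workspace in the state `z`. -/
noncomputable def rowState (i : Fin n) (g : Fin n → ℝ) (h : ℝ) (z : Fin w)
    (k : QBasis (Fin n × Fin n) w) : ℂ :=
  ((if k.1.1 = i ∧ k.2.2 = z then
    ((if k.2.1 then -g k.1.2 else g k.1.2) + if k.1.2 = 0 then h else 0) / √2 else 0 : ℝ) : ℂ)

/-- Phase kickback: `g` sits on the query bit `|0⟩ - |1⟩`, which picks up a sign, and `h` on `|0⟩ +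
|1⟩`, which is invariant. -/
theorem queryMatrix_mulVec_rowState (x : Fin n × Fin n → Bool) (i : Fin n) (g : Fin n → ℝ) (h : ℝ)
    (z : Fin w) : (queryMatrix w x).mulVec (rowState i g h z) =
      rowState i (fun j => if x (i, j) then -g j else g j) h z := by
  funext ⟨⟨r, j⟩, b, z'⟩
  simp only [queryMatrix_mulVec, rowState]
  by_cases hr : r = i
  · subst hr
    cases b <;> cases x (r, j) <;> simp
  · simp [hr]

theorem star_rowState_dotProduct (i : Fin n) (g g' : Fin n → ℝ) (h h' : ℝ) (z z' : Fin w) :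
    star (rowState i g h z) ⬝ᵥ rowState i g' h' z' =
      ((if z = z' then ∑ j, g j * g' j + h * h' else 0 : ℝ) : ℂ) := by
  have e : ∀ k, star (rowState i g h z) k * rowState i g' h' z' k =
      ((if k.1.1 = i then if k.2.2 = z then if z = z' then
        ((if k.2.1 then -g k.1.2 else g k.1.2) + if k.1.2 = 0 then h else 0) *
        ((if k.2.1 then -g' k.1.2 else g' k.1.2) + if k.1.2 = 0 then h' else 0) / 2
        else 0 else 0 else 0 : ℝ) : ℂ) := by
    intro k
    simp only [Pi.star_apply, rowState, RCLike.star_def, Complex.conj_ofReal,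
      ← Complex.ofReal_mul]
    congr 1
    by_cases h1 : k.1.1 = i
    · by_cases h2 : k.2.2 = z
      · by_cases h3 : z = z'
        · simp only [h1, h2, ← h3, and_self, if_true]
          rw [div_mul_div_comm, Real.mul_self_sqrt zero_le_two]
        · simp [h1, h2, h3]
      · simp [h2]
    · simp [h1]
  rw [dotProduct, Finset.sum_congr rfl fun k _ => e k, ← Complex.ofReal_sum]
  congr 1
  simp only [Fintype.sum_prod_type, Fintype.sum_bool, Finset.sum_ite_irrel,
    Finset.sum_const_zero, Finset.sum_ite_eq', Finset.mem_univ, if_true,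
    Bool.false_eq_true, if_false, Finset.sum_add_distrib]
  split_ifs
  · rw [← Finset.sum_add_distrib]
    have e2 : h * h' = ∑ j : Fin n, if j = 0 then h * h' else 0 := by simp
    rw [e2, ← Finset.sum_add_distrib]
    refine Finset.sum_congr rfl fun j _ => ?_
    split_ifs <;> ring
  · simp

/-- Both sides equal `cos φ * cos (φ + 2 * θ) / cos θ ^ 2`. They are the overlaps for two different
marked columns, after a query at angle `φ` and at the next angle. -/
theorem grover_identity {θ : ℝ} (hθ : Real.cos θ ≠ 0) (φ : ℝ) :
    2 * (-Real.sin φ * (Real.cos φ * Real.tan θ)) + Real.cos φ ^ 2 * (1 - Real.tan θ ^ 2) =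
      2 * (Real.sin (φ + 2 * θ) * (Real.cos (φ + 2 * θ) * Real.tan θ)) +
        Real.cos (φ + 2 * θ) ^ 2 * (1 - Real.tan θ ^ 2) := by
  have h2 : Real.sin (2 * θ) ^ 2 + Real.cos (2 * θ) ^ 2 = 1 := Real.sin_sq_add_cos_sq _
  have key : ∀ x y : ℝ, 2 * (x * (y * Real.tan θ)) + y ^ 2 * (1 - Real.tan θ ^ 2) =
      (x * y * Real.sin (2 * θ) + y ^ 2 * Real.cos (2 * θ)) / Real.cos θ ^ 2 := by
    intro x y
    rw [Real.tan_eq_sin_div_cos, Real.sin_two_mul, Real.cos_two_mul']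
    field_simp
  rw [key, key, Real.sin_add, Real.cos_add]
  congr 1
  generalize Real.sin (2 * θ) = A at h2
  generalize Real.cos (2 * θ) = B at h2
  linear_combination (Real.sin φ * Real.cos φ * A - Real.cos φ ^ 2 * B) * h2

/-- The state of the search in row `i` at angle `φ`, with marked column `m`. -/
noncomputable def searchState (θ γ : ℝ) (i m : Fin n) (φ : ℝ) (z : Fin w) :
    QBasis (Fin n × Fin n) w → ℂ :=
  rowState i (groverAmplitude m (Real.sin φ) (Real.cos φ * Real.tan θ)) (Real.cos φ * γ) z

/-- The idle amplitude `γ` absorbs the mass missing from the row, so that `n` drops out of the Gram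
matrix and `θ` can be tuned to make the search exact. -/
theorem gram_searchState {θ γ : ℝ} (hγ : γ ^ 2 = 1 - (n - 1) * Real.tan θ ^ 2)
    (i m m' : Fin n) (φ : ℝ) (z z' : Fin w) :
    star (searchState θ γ i m φ z) ⬝ᵥ searchState θ γ i m' φ z' =
      ((if z = z' then if m = m' then 1 else
        2 * (Real.sin φ * (Real.cos φ * Real.tan θ)) + Real.cos φ ^ 2 * (1 - Real.tan θ ^ 2)
        else 0 : ℝ) : ℂ) := by
  rw [searchState, searchState, star_rowState_dotProduct, sum_groverAmplitude_mul]
  congr 1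
  have := Real.sin_sq_add_cos_sq φ
  split_ifs
  · linear_combination this + Real.cos φ ^ 2 * hγ
  · linear_combination Real.cos φ ^ 2 * hγ
  · rfl

theorem gram_query_searchState {θ γ : ℝ} (hγ : γ ^ 2 = 1 - (n - 1) * Real.tan θ ^ 2)
    (hθ : Real.cos θ ≠ 0) (π π' : Equiv.Perm (Fin n)) (i : Fin n) (φ : ℝ) (z z' : Fin w) :
    star ((queryMatrix w (permBits π)).mulVec (searchState θ γ i (π i) φ z)) ⬝ᵥ
        (queryMatrix w (permBits π')).mulVec (searchState θ γ i (π' i) φ z') =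
      star (searchState θ γ i (π i) (φ + 2 * θ) z) ⬝ᵥ
        searchState θ γ i (π' i) (φ + 2 * θ) z' := by
  have hq : ∀ (ρ : Equiv.Perm (Fin n)) (z : Fin w),
      (queryMatrix w (permBits ρ)).mulVec (searchState θ γ i (ρ i) φ z) =
        rowState i (groverAmplitude (ρ i) (-Real.sin φ) (Real.cos φ * Real.tan θ))
          (Real.cos φ * γ) z := by
    intro ρ z
    rw [searchState, queryMatrix_mulVec_rowState]
    congr 1
    funext j
    simp only [permBits_eq_true, groverAmplitude]
    split_ifs <;> rfl
  rw [gram_searchState hγ, ← grover_identity hθ, hq, hq, star_rowState_dotProduct,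
    sum_groverAmplitude_mul]
  congr 1
  have := Real.sin_sq_add_cos_sq φ
  split_ifs
  · linear_combination this + Real.cos φ ^ 2 * hγ
  · linear_combination Real.cos φ ^ 2 * hγ
  · rfl

/-- At angle `θ` the marked and unmarked amplitudes coincide, so the state carries no information on
the row. -/
theorem searchState_initial {θ γ : ℝ} (hθ : Real.cos θ ≠ 0) (i m m' : Fin n) (z : Fin w) :
    searchState θ γ i m θ z = searchState θ γ i m' θ z := by
  have : ∀ m : Fin n, groverAmplitude m (Real.sin θ) (Real.cos θ * Real.tan θ) =
      fun _ => Real.sin θ := by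
    intro m
    funext j
    simp [groverAmplitude, mul_comm (Real.cos θ), Real.tan_mul_cos hθ]
  rw [searchState, searchState, this, this]

/-- The images of the first `i` rows, padded by zeros. -/
def prefixRecord (i : ℕ) (π : Equiv.Perm (Fin n)) (r : Fin n) : Fin n :=
  if (r : ℕ) < i then π r else 0

theorem prefixRecord_eq_iff {i : ℕ} {π π' : Equiv.Perm (Fin n)} :
    prefixRecord i π = prefixRecord i π' ↔ ∀ r : Fin n, (r : ℕ) < i → π r = π' r := by
  rw [funext_iff]
  refine forall_congr' fun r => ?_
  unfold prefixRecord
  split_ifs with h <;> simp [h]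

theorem prefixRecord_succ_eq_iff {i : Fin n} {π π' : Equiv.Perm (Fin n)} :
    prefixRecord (i + 1) π = prefixRecord (i + 1) π' ↔
      prefixRecord i π = prefixRecord i π' ∧ π i = π' i := by
  simp only [prefixRecord_eq_iff]
  constructor
  · exact fun h => ⟨fun r hr => h r (by omega), h i (by omega)⟩
  · rintro ⟨h, hi⟩ r hr
    rcases Nat.lt_succ_iff_lt_or_eq.1 hr with hr | hr
    · exact h r hr
    · rw [Fin.ext hr]
      exact hi

theorem prefixRecord_injective : Function.Injective (prefixRecord (n := n) n) :=
  fun _ _ h => Equiv.ext fun r => prefixRecord_eq_iff.1 h r r.2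

/-- Exact search with `k` queries in each row. -/
theorem learnQ_matching_le_mul {k : ℕ} (hk : 1 ≤ k)
    (hsin : n * Real.sin (Real.pi / (2 * (2 * k + 1))) ^ 2 ≤ 1) :
    learnQ (matchingMatrices n) ≤ (n * k : ℕ) := by
  set θ : ℝ := Real.pi / (2 * (2 * k + 1)) with hθdef
  have hk' : (1 : ℝ) ≤ k := by exact_mod_cast hk
  have hpi := Real.pi_pos
  have hcos : 0 < Real.cos θ := by
    apply Real.cos_pos_of_mem_Ioo
    constructor
    · have : 0 < θ := by positivity
      linarith
    · rw [hθdef]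
      exact div_lt_div_of_pos_left hpi two_pos (by linarith)
  obtain ⟨γ, hγ⟩ : ∃ γ : ℝ, γ ^ 2 = 1 - (n - 1) * Real.tan θ ^ 2 := by
    refine ⟨√(1 - (n - 1) * Real.tan θ ^ 2), Real.sq_sqrt ?_⟩
    rw [Real.tan_eq_sin_div_cos, div_pow, sub_nonneg, ← mul_div_assoc, div_le_one (by positivity)]
    have := Real.sin_sq_add_cos_sq θ
    linarith
  -- The angle runs from `θ` in steps of `2 * θ` and reaches `π / 2` after exactly `k` queries,
  -- where all amplitude is on the marked column.
  have hend : ((2 * (k - 1 : ℕ) + 1 : ℕ) : ℝ) * θ + 2 * θ = Real.pi / 2 := by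
    rw [hθdef]
    push_cast [Nat.cast_sub hk]
    field_simp
    ring
  let e := Fintype.equivFin (Fin n → Fin n)
  let ψ : ℕ → matchingMatrices n → QBasis (Fin n × Fin n) (Fintype.card (Fin n → Fin n)) → ℂ :=
    fun t x => searchState θ γ (Fin.ofNat n (t / k))
      ((permEquivMatching n).symm x (Fin.ofNat n (t / k))) ((2 * (t % k) + 1 : ℕ) * θ)
      (e (prefixRecord (t / k) ((permEquivMatching n).symm x)))
  have hrec₀ : ∀ π : Equiv.Perm (Fin n), prefixRecord 0 π = fun _ => 0 := fun π => by
    funext r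
    simp [prefixRecord]
  have hψ₀ : ∀ x, ψ 0 x = searchState θ γ 0 0 θ (e fun _ => 0) := by
    intro x
    simp only [ψ, Nat.zero_div, Nat.zero_mod, hrec₀]
    rw [mul_zero, zero_add, Nat.cast_one, one_mul]
    exact searchState_initial hcos.ne' _ _ _ _
  refine quantumQueryComplexity_le_of_states _ (n * k) ψ
    (fun q => permEquivMatching n (Function.invFun (prefixRecord n) (e.symm q.2.2)))
    (searchState θ γ 0 0 θ (e fun _ => 0)) hψ₀ (sum_norm_sq_eq_one ?_) ?_ ?_
  · rw [gram_searchState hγ]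
    simp
  · intro t ht x y
    obtain ⟨π, rfl⟩ := (permEquivMatching n).surjective x
    obtain ⟨ρ, rfl⟩ := (permEquivMatching n).surjective y
    simp only [ψ, Equiv.symm_apply_apply, coe_permEquivMatching]
    have hi : t / k < n := Nat.div_lt_of_lt_mul (by rwa [mul_comm])
    have hs : t % k < k := Nat.mod_lt _ hk
    rw [gram_query_searchState hγ hcos.ne']
    by_cases hlast : t % k + 1 < k
    · have h1 : (t + 1) / k = t / k := by
        rw [Nat.succ_div, if_neg, add_zero]
        intro hd
        rw [Nat.dvd_iff_mod_eq_zero, Nat.add_mod, Nat.mod_eq_of_lt (by omega : 1 < k),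
          Nat.mod_eq_of_lt hlast] at hd
        omega
      have h2 : (t + 1) % k = t % k + 1 := by
        rw [Nat.add_mod, Nat.mod_eq_of_lt (by omega : 1 < k), Nat.mod_eq_of_lt hlast]
      have h3 : ((2 * (t % k) + 1 : ℕ) : ℝ) * θ + 2 * θ = (2 * (t % k + 1) + 1 : ℕ) * θ := by
        push_cast
        ring
      rw [h1, h2, h3]
    -- End of a row: states of different columns are now orthogonal, so the Gram matrix is that of
    -- the next row's initial state with the column added to the record. After the last row the
    -- index wraps to `0`, harmlessly, as the initial state ignores the column.
    · have h4 : t % k = k - 1 := by omega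
      have h5 : t + 1 = k * (t / k + 1) := by
        have := Nat.div_add_mod t k
        rw [mul_add]
        omega
      have h1 : (t + 1) / k = t / k + 1 := by rw [h5, Nat.mul_div_cancel_left _ hk]
      have h2 : (t + 1) % k = 0 := by rw [h5, Nat.mul_mod_right]
      have h6 : ((Fin.ofNat n (t / k) : Fin n) : ℕ) = t / k := Nat.mod_eq_of_lt hi
      have h7 := prefixRecord_succ_eq_iff (i := Fin.ofNat n (t / k)) (π := π) (π' := ρ)
      rw [h6] at h7
      rw [h1, h2, h4, hend, mul_zero, zero_add, Nat.cast_one, one_mul,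
        searchState_initial hcos.ne' _ (π (Fin.ofNat n (t / k + 1))) 0,
        searchState_initial hcos.ne' _ (ρ (Fin.ofNat n (t / k + 1))) 0,
        gram_searchState hγ, gram_searchState hγ]
      congr 1
      simp only [Real.cos_pi_div_two, e.injective.eq_iff, h7]
      by_cases ha : prefixRecord (t / k) π = prefixRecord (t / k) ρ <;> simp [ha]
  · intro x q hq
    obtain ⟨π, rfl⟩ := (permEquivMatching n).surjective x
    simp only [ψ, Nat.mul_div_cancel n hk, Equiv.symm_apply_apply] at hq
    have hz : q.2.2 = e (prefixRecord n π) := by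
      by_contra hne
      exact hq (by simp [searchState, rowState, hne])
    rw [hz, Equiv.symm_apply_apply, Function.leftInverse_invFun prefixRecord_injective]
    rfl

end GroverStates

theorem learnQ_matching_le {n : ℕ} (hn : 1 ≤ n) :
    learnQ (matchingMatrices n) ≤ (n * ⌈√(n : ℝ)⌉₊ : ℕ) := by
  have : NeZero n := ⟨by omega⟩
  have hn0 : (0 : ℝ) < n := by exact_mod_cast hn
  have hr : 0 < √(n : ℝ) := Real.sqrt_pos.2 hn0
  have hk : √(n : ℝ) ≤ ⌈√(n : ℝ)⌉₊ := Nat.le_ceil _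
  refine learnQ_matching_le_mul (Nat.ceil_pos.2 hr) ?_
  set k : ℝ := (⌈√(n : ℝ)⌉₊ : ℝ)
  have hpi := Real.pi_pos
  -- Since `π < 4`, `k ≥ √n` suffices; `sin x ≤ x` then gives the condition on `θ`.
  have h1 : Real.pi / (2 * (2 * k + 1)) ≤ 1 / √(n : ℝ) := by
    rw [div_le_div_iff₀ (by positivity) hr]
    nlinarith [Real.pi_lt_four]
  have h0 : 0 ≤ Real.pi / (2 * (2 * k + 1)) := by positivity
  have h2 : |Real.sin (Real.pi / (2 * (2 * k + 1)))| ≤ 1 / √(n : ℝ) :=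
    (Real.abs_sin_le_abs).trans (by rwa [abs_of_nonneg h0])
  calc n * Real.sin (Real.pi / (2 * (2 * k + 1))) ^ 2
      ≤ n * (1 / √(n : ℝ)) ^ 2 := by
        rw [← sq_abs]
        gcongr
    _ = 1 := by
        rw [div_pow, Real.sq_sqrt hn0.le]
        field_simp

theorem theorem1 :
    (∀ n : ℕ, learnD (matchingMatrices n) = ((n * (n - 1) / 2 : ℕ) : ℕ∞)) ∧
    (∃ c C : ℝ, 0 < c ∧ 0 < C ∧ ∀ n : ℕ, 1 ≤ n →
      ∃ r : ℕ, learnR (matchingMatrices n) = (r : ℕ∞) ∧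
        (2 ≤ n → c * (n : ℝ) ^ 2 ≤ (r : ℝ)) ∧ (r : ℝ) ≤ C * (n : ℝ) ^ 2) ∧
    (∃ c C : ℝ, 0 < c ∧ 0 < C ∧ ∀ n : ℕ, 1 ≤ n →
      ∃ q : ℕ, learnQ (matchingMatrices n) = (q : ℕ∞) ∧
        (2 ≤ n → c * (n : ℝ) ^ (3 / 2 : ℝ) ≤ (q : ℝ)) ∧
          (q : ℝ) ≤ C * (n : ℝ) ^ (3 / 2 : ℝ)) := by
  refine ⟨learnD_matching, ⟨1 / 25, 1, by norm_num, by norm_num, fun n hn => ?_⟩,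
    ⟨1 / 288, 2, by norm_num, by norm_num, fun n hn => ?_⟩⟩
  · have hle := (learnR_le_learnD (matchingMatrices n)).trans (learnD_matching n).le
    obtain ⟨r, hr, hrle⟩ := ENat.le_natCast_iff.1 hle
    refine ⟨r, hr, fun h2 => ?_, ?_⟩
    · have h := le_learnR_matching h2
      rw [hr, Nat.cast_le, Nat.ceil_le] at h
      linarith
    · have : r ≤ n ^ 2 := hrle.trans ((Nat.div_le_self _ _).trans (by
        rw [sq]
        exact Nat.mul_le_mul_left n (Nat.sub_le n 1)))
      rw [one_mul]
      exact_mod_cast this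
  · obtain ⟨q, hq, hqle⟩ := ENat.le_natCast_iff.1 (learnQ_matching_le hn)
    refine ⟨q, hq, fun h2 => ?_, ?_⟩
    · have h : ((⌈1 / 288 * (n : ℝ) ^ (3 / 2 : ℝ)⌉₊ : ℕ) : ℕ∞) ≤ learnQ (matchingMatrices n) :=
        le_iInf₂ fun A hA => Nat.cast_le.2 (Nat.ceil_le.2 (le_queries_of_computes_matching h2 A hA))
      rw [hq, Nat.cast_le, Nat.ceil_le] at h
      exact h
    · have hn0 : (1 : ℝ) ≤ n := by exact_mod_cast hn
      have hc : (⌈√(n : ℝ)⌉₊ : ℝ) ≤ 2 * √(n : ℝ) := by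
        have h1 := (Nat.ceil_lt_add_one (Real.sqrt_nonneg (n : ℝ))).le
        have h2 : 1 ≤ √(n : ℝ) := Real.one_le_sqrt.2 hn0
        linarith
      rw [show (3 / 2 : ℝ) = 1 + 1 / 2 by norm_num, Real.rpow_add (by linarith), Real.rpow_one,
        ← Real.sqrt_eq_rpow]
      calc (q : ℝ) ≤ ((n * ⌈√(n : ℝ)⌉₊ : ℕ) : ℝ) := Nat.cast_le.2 hqle
        _ ≤ n * (2 * √(n : ℝ)) := by
          push_cast
          gcongr
        _ = 2 * (n * √(n : ℝ)) := by ring
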